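/- Let $X\in\mathbb{R}^{N\times d}$ have rank $r$ and singular value decomposition $X=U\Sigma V^{T}$, where $U\in\mathbb{R}^{N\times r}$ and $V\in\mathbb{R}^{d\times r}$ have orthonormal columns and $\Sigma=\mathrm{diag}(\sigma_1,\dots,\sigma_r)$ with $\sigma_1\ge\dots\ge\sigma_r>0$; put $\sigma_j=0$ for $j>r$. Let $k\le r$, let $V_k\in\mathbb{R}^{d\times k}$ consist of the first $k$ columns of $V$, and let $S$ be a random subset of $[d]=\{1,\dots,d\}$ drawn from the projection determinantal point process (DPP) of marginal kernel $K=V_kV_k^{T}$, that is, $\mathbb{P}(T\subseteq S)=\det (K_{i,j})_{i,j\in T}$ for all $T\subseteq[d]$ (so that $|S|=k$ almost surely). Let $\|\cdot\|_2$ and $\|\cdot\|_{\mathrm{Fr}}$ be the spectral and Frobenius norms. For $\nu\in\{2,\mathrm{Fr}\}$, let $\Pi_kX$ be a best approximation of $X$ in the norm $\|\cdot\|_\nu$ among matrices of rank at most $k$, and, for $|S|=k$, let $\Pi_S^{\nu}X$ be a minimizer of $\|X-A\|_\nu$ over the matrices $A=X_{:,S}B$ with $B\in\mathbb{R}^{k\times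 d}$. Let $$p=\#\Big\{i\in[d]:\ \ell_i^k\ne0\Big\},\qquad \ell^k_i=\sum_{j=1}^k V_{i,j}^2,\qquad\qquad \beta=\sigma_{k+1}^2\Big(\frac1{d-k}\sum_{j=k+1}^{d}\sigma_j^2\Big)^{-1}$$ be the number of nonzero $k$-leverage scores and the flatness parameter (quotients with zero denominator are read as $0$; this only concerns $k=r$, where $X=\Pi_kX$). Then $$\mathbb{E}\,\|X-\Pi_S^{2}X\|_2^2\ \le\ \bigl(1+k(p-k)\bigr)\,\|X-\Pi_kX\|_2^2$$ and $$\mathbb{E}\,\|X-\Pi_S^{\mathrm{Fr}}X\|_{\mathrm{Fr}}^2\ \le\ \Big(1+\beta\,\frac{p-k}{d-k}\,k\Big)\,\|X-\Pi_kX\|_{\mathrm{Fr}}^2 .$$ -/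

import Mathlib

/-- `(U, σ, V)` is a (thin) singular value decomposition `X = U diag(σ) Vᵀ` of the `N × d` matrix
`X`: `U` and `V` have orthonormal columns, and `σ 0 ≥ σ 1 ≥ ... > 0`. The number `r` of columns of
`U` and `V` is then the rank of `X`. -/
structure IsSVD {N d r : ℕ} (X : Matrix (Fin N) (Fin d) ℝ) (U : Matrix (Fin N) (Fin r) ℝ)
    (σ : Fin r → ℝ) (V : Matrix (Fin d) (Fin r) ℝ) : Prop where
  left_orthonormal : U.transpose * U = 1
  right_orthonormal : V.transpose * V = 1
  pos : ∀ i, 0 < σ i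
  antitone : Antitone σ
  eq_mul : X = U * Matrix.diagonal σ * V.transpose

/-- The first `k` columns `V_k` of `V`. -/
def firstCols {d r : ℕ} (V : Matrix (Fin d) (Fin r) ℝ) (k : ℕ) (hk : k ≤ r) :
    Matrix (Fin d) (Fin k) ℝ :=
  V.submatrix id (Fin.castLE hk)

/-- The singular value of (zero-based) index `i`, read as `0` beyond the rank. -/
def singVal {r : ℕ} (σ : Fin r → ℝ) (i : ℕ) : ℝ :=
  if h : i < r then σ ⟨i, h⟩ else 0

/-- The flatness parameter
`β = σ_{k+1}² ((1 / (d - k)) ∑_{j ≥ k+1} σ_j²)⁻¹` (one-based indices). -/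
noncomputable def flatness {r : ℕ} (d k : ℕ) (σ : Fin r → ℝ) : ℝ :=
  singVal σ k ^ 2 * (1 / ((d : ℝ) - (k : ℝ)) * ∑ j ∈ Finset.Ico k d, singVal σ j ^ 2)⁻¹

/-- The `k`-leverage score of index `i`: the squared norm of the `i`-th row of `V_k`. -/
def leverageScore {d k : ℕ} (W : Matrix (Fin d) (Fin k) ℝ) (i : Fin d) : ℝ :=
  ∑ j, W i j ^ 2

/-- The number `p` of nonzero `k`-leverage scores. -/
noncomputable def sparsity {d k : ℕ} (W : Matrix (Fin d) (Fin k) ℝ) : ℕ :=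
  Set.ncard {i : Fin d | leverageScore W i ≠ 0}

open scoped Matrix.Norms.L2Operator in
/-- The spectral norm. -/
noncomputable def specNorm {m n : ℕ} (A : Matrix (Fin m) (Fin n) ℝ) : ℝ := ‖A‖

open scoped Matrix.Norms.Frobenius in
/-- The Frobenius norm. -/
noncomputable def frobNorm {m n : ℕ} (A : Matrix (Fin m) (Fin n) ℝ) : ℝ := ‖A‖

/-- The law `μ` of a random subset of `[d]` is the determinantal point process of marginal kernel
`K`: the probability that the random subset contains `S` is `det K_S`, for every `S`. -/
def IsDPP {d : ℕ} (K : Matrix (Fin d) (Fin d) ℝ) (μ : PMF (Finset (Fin d))) : Prop :=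
  ∀ S : Finset (Fin d), (∑ T with S ⊆ T, (μ T).toReal) =
    (K.submatrix (fun i : {i // i ∈ S} => (i : Fin d)) (fun i : {i // i ∈ S} => (i : Fin d))).det

/-- Expectation of `f` under the law `μ` of a random subset of `[d]`. -/
noncomputable def expectation {d : ℕ} (μ : PMF (Finset (Fin d))) (f : Finset (Fin d) → ℝ) : ℝ :=
  ∑ S, (μ S).toReal * f S

/-- `A` minimizes `ν (X - A)` over the matrices in `𝒜`. -/
def IsBestApprox {N d : ℕ} (ν : Matrix (Fin N) (Fin d) ℝ → ℝ) (X : Matrix (Fin N) (Fin d) ℝ)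
    (𝒜 : Set (Matrix (Fin N) (Fin d) ℝ)) (A : Matrix (Fin N) (Fin d) ℝ) : Prop :=
  A ∈ 𝒜 ∧ ∀ A' ∈ 𝒜, ν (X - A) ≤ ν (X - A')

/-- The `N × d` matrices of rank at most `k`. -/
def rankLE (N d k : ℕ) : Set (Matrix (Fin N) (Fin d) ℝ) :=
  {A | A.rank ≤ k}

/-- The submatrix `X_{:,S}` made of the columns of `X` indexed by `S`. -/
def colSubmatrix {N d : ℕ} (X : Matrix (Fin N) (Fin d) ℝ) (S : Finset (Fin d)) :
    Matrix (Fin N) {i // i ∈ S} ℝ :=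
  X.submatrix id (fun i => (i : Fin d))

/-- The matrices `X_{:,S} B` with `B` of rank at most `k`. -/
def colSpanRankLE {N d : ℕ} (X : Matrix (Fin N) (Fin d) ℝ) (S : Finset (Fin d)) (k : ℕ) :
    Set (Matrix (Fin N) (Fin d) ℝ) :=
  {A | ∃ B : Matrix {i // i ∈ S} (Fin d) ℝ, B.rank ≤ k ∧ A = colSubmatrix X S * B}

/-!
Let `K = V_k V_kᵀ`. Whenever `μ S ≠ 0`, the minor `det K_S` is nonzero and `#S = k`, and the
oblique projection `P = I_{:,S} K_{S,S}⁻¹ K_{S,:}` satisfies `K P = K` and `P K = P`. Hence `X P`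
competes with the best approximation of `X` from the columns in `S`, and its error splits
orthogonally, `X - X P = (X - X K) - (X - X K) (P - K)`, so that
`‖X - X P‖² ≤ ‖X - X K‖² + σ_{k+1}² (‖P‖_Fr² - k)` in both norms.

By Cramer's rule the squared entry of `K_{S,S}⁻¹ K_{S,:}` at `(s, j)`, multiplied by
`det K_S = μ S`, is the probability `μ (S \ {s} ∪ {j})` of the exchanged set. All sets of positive
probability consist of `k` of the `p` indices with nonzero leverage score, and each of them arises
from `k (p + 1 - k)` exchanges, which gives `𝔼 ‖P‖_Fr² ≤ k + k (p - k)`. The Eckart–Young bounds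
compare `‖X - X K‖` with `‖X - Π_k X‖`.
-/

open Matrix

lemma gram_mul_left_isometry {ι κ ν R : Type*} [Fintype ι] [Fintype κ] [DecidableEq κ]
    [CommRing R] {U : Matrix ι κ R} (hU : Uᵀ * U = 1) (A : Matrix κ ν R) :
    (U * A)ᵀ * (U * A) = Aᵀ * A := by
  rw [transpose_mul, Matrix.mul_assoc, ← Matrix.mul_assoc Uᵀ, hU, Matrix.one_mul]

section Norms

variable {l m n : ℕ}

lemma specNorm_nonneg (A : Matrix (Fin m) (Fin n) ℝ) : 0 ≤ specNorm A := by
  open scoped Matrix.Norms.L2Operator in exact norm_nonneg A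

lemma frobNorm_nonneg (A : Matrix (Fin m) (Fin n) ℝ) : 0 ≤ frobNorm A := by
  open scoped Matrix.Norms.Frobenius in exact norm_nonneg A

lemma specNorm_add_le (A B : Matrix (Fin m) (Fin n) ℝ) :
    specNorm (A + B) ≤ specNorm A + specNorm B := by
  open scoped Matrix.Norms.L2Operator in exact norm_add_le A B

lemma specNorm_mul_le (A : Matrix (Fin m) (Fin n) ℝ) (B : Matrix (Fin n) (Fin l) ℝ) :
    specNorm (A * B) ≤ specNorm A * specNorm B := by
  open scoped Matrix.Norms.L2Operator in exact l2_opNorm_mul A B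

lemma specNorm_diagonal (v : Fin n → ℝ) : specNorm (diagonal v) = ‖v‖ := by
  open scoped Matrix.Norms.L2Operator in exact l2_opNorm_diagonal v

lemma specNorm_transpose (A : Matrix (Fin m) (Fin n) ℝ) : specNorm Aᵀ = specNorm A := by
  open scoped Matrix.Norms.L2Operator in exact l2_opNorm_conjTranspose A

lemma specNorm_transpose_mul_self (A : Matrix (Fin m) (Fin n) ℝ) :
    specNorm (Aᵀ * A) = specNorm A ^ 2 := by
  open scoped Matrix.Norms.L2Operator in
    exact (l2_opNorm_conjTranspose_mul_self A).trans (sq _).symm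

lemma specNorm_mul_transpose_self (A : Matrix (Fin m) (Fin n) ℝ) :
    specNorm (A * Aᵀ) = specNorm A ^ 2 := by
  rw [← specNorm_transpose A, ← specNorm_transpose_mul_self, transpose_transpose]

lemma specNorm_mul_left_isometry {U : Matrix (Fin m) (Fin n) ℝ} (hU : Uᵀ * U = 1)
    (A : Matrix (Fin n) (Fin l) ℝ) : specNorm (U * A) = specNorm A := by
  refine (sq_eq_sq₀ (specNorm_nonneg _) (specNorm_nonneg _)).1 ?_
  rw [← specNorm_transpose_mul_self, gram_mul_left_isometry hU, specNorm_transpose_mul_self]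

lemma mulVec_dotProduct_mulVec_le (A : Matrix (Fin m) (Fin n) ℝ) (x : Fin n → ℝ) :
    (A *ᵥ x) ⬝ᵥ (A *ᵥ x) ≤ specNorm A ^ 2 * (x ⬝ᵥ x) := by
  open scoped Matrix.Norms.L2Operator in
    have h := pow_le_pow_left₀ (norm_nonneg _) (l2_opNorm_mulVec A (WithLp.toLp 2 x)) 2
    rw [mul_pow, EuclideanSpace.real_norm_sq_eq, EuclideanSpace.real_norm_sq_eq] at h
    simp only [dotProduct, ← sq]
    exact h

lemma frobNorm_sq (A : Matrix (Fin m) (Fin n) ℝ) : frobNorm A ^ 2 = ∑ i, ∑ j, A i j ^ 2 := by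
  have h : frobNorm A = (∑ i, ∑ j, ‖A i j‖ ^ (2 : ℝ)) ^ (1 / 2 : ℝ) := frobenius_norm_def A
  rw [h, ← Real.sqrt_eq_rpow, Real.sq_sqrt (by positivity)]
  simp

lemma frobNorm_sq_eq_trace (A : Matrix (Fin m) (Fin n) ℝ) :
    frobNorm A ^ 2 = (A * Aᵀ).trace := by
  rw [frobNorm_sq]
  simp only [trace, diag_apply, mul_apply, transpose_apply, sq]

lemma frobNorm_transpose (A : Matrix (Fin m) (Fin n) ℝ) : frobNorm Aᵀ = frobNorm A := by
  open scoped Matrix.Norms.Frobenius in exact frobenius_norm_transpose A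

lemma frobNorm_mul_left_isometry {U : Matrix (Fin m) (Fin n) ℝ} (hU : Uᵀ * U = 1)
    (A : Matrix (Fin n) (Fin l) ℝ) : frobNorm (U * A) = frobNorm A := by
  refine (sq_eq_sq₀ (frobNorm_nonneg _) (frobNorm_nonneg _)).1 ?_
  rw [frobNorm_sq_eq_trace, trace_mul_comm, gram_mul_left_isometry hU, trace_mul_comm,
    frobNorm_sq_eq_trace]

lemma specNorm_le_frobNorm (A : Matrix (Fin m) (Fin n) ℝ) : specNorm A ≤ frobNorm A := by
  open scoped Matrix.Norms.L2Operator in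
    refine ContinuousLinearMap.opNorm_le_bound _ (frobNorm_nonneg A) fun x => ?_
    refine le_of_sq_le_sq ?_ (mul_nonneg (frobNorm_nonneg A) (norm_nonneg x))
    rw [mul_pow, EuclideanSpace.real_norm_sq_eq, EuclideanSpace.real_norm_sq_eq, frobNorm_sq,
      Finset.sum_mul]
    exact Finset.sum_le_sum fun i _ => Finset.sum_mul_sq_le_sq_mul_sq Finset.univ (A i) x

lemma frobNorm_mul_sq_le (A : Matrix (Fin m) (Fin n) ℝ) (B : Matrix (Fin n) (Fin l) ℝ) :
    frobNorm (A * B) ^ 2 ≤ specNorm A ^ 2 * frobNorm B ^ 2 := by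
  rw [← frobNorm_transpose, ← frobNorm_transpose B, frobNorm_sq, frobNorm_sq, Finset.mul_sum]
  refine Finset.sum_le_sum fun j _ => ?_
  simpa only [dotProduct, ← sq, mulVec, mul_apply, transpose_apply] using
    mulVec_dotProduct_mulVec_le A (Bᵀ j)

end Norms

section PrincipalMinors

variable {ι κ R : Type*} [DecidableEq ι]

/-- The principal minor `det K_S` of the rows and columns of `K` indexed by `S`. -/
def principalMinor [CommRing R] (K : Matrix ι ι R) (S : Finset ι) : R :=
  (K.submatrix (Subtype.val : S → ι) Subtype.val).det

lemma principalMinor_singleton [CommRing R] (K : Matrix ι ι R) (i : ι) :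
    principalMinor K {i} = K i i := by
  rw [principalMinor, det_unique]
  rfl

lemma principalMinor_image_univ [CommRing R] [Fintype κ] [DecidableEq κ] (K : Matrix ι ι R)
    {g : κ → ι} (hg : Function.Injective g) :
    principalMinor K (Finset.univ.image g) = (K.submatrix g g).det := by
  let e : κ ≃ (Finset.univ.image g : Finset ι) :=
    (Equiv.ofInjective g hg).trans (Equiv.subtypeEquivRight fun i => by simp)
  exact (det_submatrix_equiv_self e _).symm

lemma principalMinor_eq_zero_of_rank_lt [Field R] [Fintype ι] {K : Matrix ι ι R} {S : Finset ι}
    (h : K.rank < S.card) : principalMinor K S = 0 := by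
  by_contra hdet
  have hrank := rank_of_isUnit _ ((isUnit_iff_isUnit_det _).2 (Ne.isUnit hdet))
  have hle := rank_submatrix_le K (Subtype.val : S → ι) (Subtype.val : S → ι)
  rw [hrank, Fintype.card_coe] at hle
  exact absurd h hle.not_gt

lemma image_update_val_univ {S : Finset ι} (s : S) (j : ι) :
    Finset.univ.image (Function.update Subtype.val s j) = insert j (S.erase s) := by
  ext i
  simp only [Finset.mem_image, Finset.mem_univ, true_and, Finset.mem_insert, Finset.mem_erase]
  constructor
  · rintro ⟨t, rfl⟩
    by_cases ht : t = s
    · simp [ht]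
    · simp [ht, Subtype.coe_ne_coe.2 ht]
  · rintro (rfl | ⟨his, hiS⟩)
    · exact ⟨s, Function.update_self ..⟩
    · exact ⟨⟨i, hiS⟩, Function.update_of_ne (fun h => his (congrArg Subtype.val h)) ..⟩

end PrincipalMinors

section ObliqueProjection

variable {ι κ R : Type*} [Fintype ι] [DecidableEq ι] [CommRing R]

/-- The matrix `K_{S,S}⁻¹ K_{S,:}` of coefficients of the columns indexed by `S` in the oblique
projection of kernel `K`; it is meaningful when `principalMinor K S` is invertible. -/
noncomputable def obliqueCoeff (K : Matrix ι ι R) (S : Finset ι) : Matrix S ι R :=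
  (K.submatrix (Subtype.val : S → ι) (Subtype.val : S → ι))⁻¹ *
    K.submatrix (Subtype.val : S → ι) id

/-- The oblique projection `P` onto the coordinates indexed by `S`, so that `X * P` is a
combination of the columns `X_{:,S}`. For an orthogonal projection `K` of rank `#S` with
`principalMinor K S` invertible it satisfies `P * K = P` and `K * P = K`. -/
noncomputable def obliqueProj (K : Matrix ι ι R) (S : Finset ι) : Matrix ι ι R :=
  (1 : Matrix ι ι R).submatrix id (Subtype.val : S → ι) * obliqueCoeff K S

lemma mul_obliqueProj_eq (X : Matrix κ ι R) (K : Matrix ι ι R) (S : Finset ι) :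
    X * obliqueProj K S = X.submatrix id (Subtype.val : S → ι) * obliqueCoeff K S := by
  rw [obliqueProj, ← Matrix.mul_assoc]
  congr 1
  ext i s
  simp [mul_apply, one_apply]

lemma obliqueProj_mul {K : Matrix ι ι R} (hK : K * K = K) (S : Finset ι) :
    obliqueProj K S * K = obliqueProj K S := by
  have hrows : K.submatrix (Subtype.val : S → ι) id * K = K.submatrix (Subtype.val : S → ι) id :=
    congrArg (submatrix · (Subtype.val : S → ι) id) hK
  rw [obliqueProj, obliqueCoeff, Matrix.mul_assoc, Matrix.mul_assoc, hrows]

lemma mul_transpose_mul_obliqueProj [Fintype κ] (W : Matrix ι κ R) {S : Finset ι}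
    (hS : S.card = Fintype.card κ) (hdet : IsUnit (principalMinor (W * Wᵀ) S)) :
    W * Wᵀ * obliqueProj (W * Wᵀ) S = W * Wᵀ := by
  classical
  set C : Matrix S κ R := W.submatrix (Subtype.val : S → ι) id
  have hright : C * (Cᵀ * (C * Cᵀ)⁻¹) = 1 := by
    rw [← Matrix.mul_assoc]
    exact mul_nonsing_inv _ hdet
  have hleft : Cᵀ * (C * Cᵀ)⁻¹ * C = 1 :=
    (mul_eq_one_comm_of_card_eq _ _ _ ((Fintype.card_coe S).trans hS)).1 hright
  calc W * Wᵀ * obliqueProj (W * Wᵀ) S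
      = W * Cᵀ * ((C * Cᵀ)⁻¹ * (C * Wᵀ)) := mul_obliqueProj_eq _ _ _
    _ = W * (Cᵀ * (C * Cᵀ)⁻¹ * C) * Wᵀ := by simp only [Matrix.mul_assoc]
    _ = W * Wᵀ := by rw [hleft, Matrix.mul_one]

variable {K : Matrix ι ι R} {S : Finset ι}

/-- Replacing the row `s` of `K_{S,:}` by the row `j` of `K` amounts to multiplying by a matrix of
determinant `obliqueCoeff K S s j`, as in Cramer's rule. -/
lemma obliqueCoeff_sq_mul_principalMinor (hsymm : Kᵀ = K) (hK : K * obliqueProj K S = K) (s : S)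
    (j : ι) : obliqueCoeff K S s j ^ 2 * principalMinor K S =
      (K.submatrix (Function.update Subtype.val s j) (Function.update Subtype.val s j)).det := by
  let e : S → ι := Subtype.val
  set g : S → ι := Function.update Subtype.val s j
  set M : Matrix S S R := (1 : Matrix S S R).updateRow s fun i => obliqueCoeff K S i j
  have hM : M.det = obliqueCoeff K S s j := by
    rw [← cramer_transpose_apply, transpose_one, cramer_one]
    rfl
  have hrow : (obliqueCoeff K S)ᵀ * K.submatrix e id = K := by
    rw [mul_obliqueProj_eq] at hK
    have h := congrArg transpose hK
    rwa [transpose_mul, transpose_submatrix, hsymm] at h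
  have hswap : K.submatrix g id = M * K.submatrix e id := by
    rw [updateRow_mul, Matrix.one_mul]
    ext i l
    by_cases hi : i = s
    · have hg : g i = j := hi ▸ Function.update_self ..
      rw [hi, updateRow_self, submatrix_apply, ← hi, hg]
      exact (congrFun (congrFun hrow j) l).symm
    · have hg : g i = i := Function.update_of_ne hi ..
      rw [updateRow_ne hi, submatrix_apply, hg]
      rfl
  have hleft : K.submatrix g e = M * K.submatrix e e :=
    congrArg (submatrix · id e) hswap
  have hright : K.submatrix e g = (K.submatrix g e)ᵀ := by
    rw [transpose_submatrix, hsymm]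
  have hboth : K.submatrix g g = M * (M * K.submatrix e e)ᵀ :=
    calc K.submatrix g g = M * K.submatrix e g := congrArg (submatrix · id g) hswap
      _ = _ := by rw [hright, hleft]
  rw [hboth, det_mul, det_transpose, det_mul, hM, principalMinor]
  ring

lemma obliqueCoeff_sq_mul_principalMinor_of_notMem (hsymm : Kᵀ = K)
    (hK : K * obliqueProj K S = K) (s : S) {j : ι} (hj : j ∉ S.erase s) :
    obliqueCoeff K S s j ^ 2 * principalMinor K S =
      principalMinor K (insert j (S.erase s)) := by
  have hinj : Function.Injective (Function.update (Subtype.val : S → ι) s j) := by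
    rw [← Set.injOn_univ, ← Finset.coe_univ]
    refine Finset.injOn_of_card_image_eq ?_
    rw [image_update_val_univ, Finset.card_insert_of_notMem hj, Finset.card_erase_add_one s.2,
      Finset.card_univ, Fintype.card_coe]
  rw [obliqueCoeff_sq_mul_principalMinor hsymm hK, ← principalMinor_image_univ K hinj,
    image_update_val_univ]

lemma obliqueCoeff_sq_mul_principalMinor_of_mem (hsymm : Kᵀ = K)
    (hK : K * obliqueProj K S = K) (s : S) {j : ι} (hj : j ∈ S.erase s) :
    obliqueCoeff K S s j ^ 2 * principalMinor K S = 0 := by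
  obtain ⟨hjs, hjS⟩ := Finset.mem_erase.1 hj
  have hne : (⟨j, hjS⟩ : S) ≠ s := fun h => hjs (congrArg Subtype.val h)
  rw [obliqueCoeff_sq_mul_principalMinor hsymm hK]
  refine det_zero_of_row_eq hne (funext fun t => ?_)
  simp [Function.update_of_ne hne]

lemma sum_obliqueCoeff_sq_mul_principalMinor (hsymm : Kᵀ = K) (hK : K * obliqueProj K S = K) :
    (∑ s, ∑ j, obliqueCoeff K S s j ^ 2) * principalMinor K S =
      ∑ s ∈ S, ∑ j ∈ (S.erase s)ᶜ, principalMinor K (insert j (S.erase s)) := by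
  rw [Finset.sum_mul, ← Finset.sum_coe_sort S]
  refine Finset.sum_congr rfl fun s _ => ?_
  rw [Finset.sum_mul, ← Finset.sum_add_sum_compl (S.erase s),
    Finset.sum_eq_zero fun j hj => obliqueCoeff_sq_mul_principalMinor_of_mem hsymm hK s hj,
    zero_add]
  exact Finset.sum_congr rfl fun j hj =>
    obliqueCoeff_sq_mul_principalMinor_of_notMem hsymm hK s (Finset.mem_compl.1 hj)

end ObliqueProjection

lemma frobNorm_obliqueProj_sq {d : ℕ} (K : Matrix (Fin d) (Fin d) ℝ) (S : Finset (Fin d)) :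
    frobNorm (obliqueProj K S) ^ 2 = ∑ s, ∑ j, obliqueCoeff K S s j ^ 2 := by
  have hE : ((1 : Matrix (Fin d) (Fin d) ℝ).submatrix id (Subtype.val : S → Fin d))ᵀ *
      (1 : Matrix (Fin d) (Fin d) ℝ).submatrix id (Subtype.val : S → Fin d) = 1 := by
    change ((1 : Matrix (Fin d) (Fin d) ℝ)ᵀ * 1).submatrix (Subtype.val : S → Fin d)
      (Subtype.val : S → Fin d) = 1
    rw [transpose_one, Matrix.one_mul, submatrix_one _ Subtype.val_injective]
  rw [frobNorm_sq_eq_trace, trace_mul_comm, obliqueProj, gram_mul_left_isometry hE,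
    trace_mul_comm]
  simp only [trace, diag_apply, mul_apply, transpose_apply, sq]

lemma mul_self_eq_self_of_mul_eq {G : Type*} [Semigroup G] {a b : G} (hab : a * b = a)
    (hba : b * a = b) : a * a = a :=
  calc a * a = a * b * a := by rw [hab]
    _ = a := by rw [mul_assoc, hba, hab]

section ObliqueError

lemma gram_sub_mul_oblique {ι κ R : Type*} [Fintype ι] [CommRing R] {K P : Matrix ι ι R}
    (hsymm : Kᵀ = K) (hKP : K * P = K) (hPK : P * K = P) (X : Matrix κ ι R) :
    (X - X * P) * (X - X * P)ᵀ = (X - X * K) * (X - X * K)ᵀ +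
      ((X - X * K) * (P - K)) * ((X - X * K) * (P - K))ᵀ := by
  have hK : K * K = K := mul_self_eq_self_of_mul_eq hKP hPK
  set Y := X - X * K
  have hYK : Y * K = 0 := by rw [Matrix.sub_mul, Matrix.mul_assoc, hK, sub_self]
  have hsplit : X - X * P = Y - Y * (P - K) := by
    rw [Matrix.mul_sub, hYK, Matrix.sub_mul, Matrix.mul_assoc, hKP, sub_zero,
      sub_sub_sub_cancel_right]
  have horth : Y * (Y * (P - K))ᵀ = 0 := by
    have hPKK : (P - K) * K = P - K := by rw [Matrix.sub_mul, hPK, hK]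
    rw [← hPKK, transpose_mul, transpose_mul, hsymm, ← Matrix.mul_assoc, ← Matrix.mul_assoc, hYK,
      Matrix.zero_mul, Matrix.zero_mul]
  have horth' : Y * (P - K) * Yᵀ = 0 := by
    simpa only [transpose_mul, transpose_transpose, transpose_zero] using congrArg transpose horth
  clear_value Y
  rw [hsplit, transpose_sub, Matrix.mul_sub, Matrix.sub_mul, Matrix.sub_mul, horth, horth']
  abel

variable {N d : ℕ} {K P : Matrix (Fin d) (Fin d) ℝ}

lemma frobNorm_oblique_sub_sq (hsymm : Kᵀ = K) (hKP : K * P = K) (hPK : P * K = P) :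
    frobNorm (P - K) ^ 2 = frobNorm P ^ 2 - K.trace := by
  have htrace : P.trace = K.trace := by rw [← hPK, trace_mul_comm, hKP]
  have hKPt : K * Pᵀ = Pᵀ := by
    simpa only [transpose_mul, hsymm] using congrArg transpose hPK
  have hK : K * K = K := mul_self_eq_self_of_mul_eq hKP hPK
  rw [frobNorm_sq_eq_trace, frobNorm_sq_eq_trace, transpose_sub, Matrix.mul_sub, Matrix.sub_mul,
    Matrix.sub_mul, hsymm, hPK, hK, hKPt, trace_sub, trace_sub, trace_sub, trace_transpose, htrace]
  ring

lemma frobNorm_sub_mul_oblique_sq_le (hsymm : Kᵀ = K) (hKP : K * P = K) (hPK : P * K = P)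
    (X : Matrix (Fin N) (Fin d) ℝ) :
    frobNorm (X - X * P) ^ 2 ≤
      frobNorm (X - X * K) ^ 2 + specNorm (X - X * K) ^ 2 * (frobNorm P ^ 2 - K.trace) := by
  rw [frobNorm_sq_eq_trace (X - X * P), gram_sub_mul_oblique hsymm hKP hPK, trace_add,
    ← frobNorm_sq_eq_trace, ← frobNorm_sq_eq_trace, ← frobNorm_oblique_sub_sq hsymm hKP hPK]
  gcongr
  exact frobNorm_mul_sq_le _ _

lemma specNorm_sub_mul_oblique_sq_le (hsymm : Kᵀ = K) (hKP : K * P = K) (hPK : P * K = P)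
    (X : Matrix (Fin N) (Fin d) ℝ) :
    specNorm (X - X * P) ^ 2 ≤
      specNorm (X - X * K) ^ 2 + specNorm (X - X * K) ^ 2 * (frobNorm P ^ 2 - K.trace) := by
  rw [← specNorm_mul_transpose_self, gram_sub_mul_oblique hsymm hKP hPK,
    ← frobNorm_oblique_sub_sq hsymm hKP hPK]
  refine (specNorm_add_le _ _).trans ?_
  rw [specNorm_mul_transpose_self, specNorm_mul_transpose_self, ← mul_pow]
  have hQ : specNorm ((X - X * K) * (P - K)) ≤ specNorm (X - X * K) * frobNorm (P - K) :=
    (specNorm_mul_le _ _).trans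
      (mul_le_mul_of_nonneg_left (specNorm_le_frobNorm _) (specNorm_nonneg _))
  gcongr
  exact specNorm_nonneg _

end ObliqueError

lemma sum_sum_sdiff_erase_const {ι M : Type*} [DecidableEq ι] [AddCommMonoid M] {L S : Finset ι}
    (hSL : S ⊆ L) (a : M) :
    ∑ s ∈ S, ∑ _j ∈ L \ S.erase s, a = (S.card * (L.card + 1 - S.card)) • a := by
  have hinner : ∀ s ∈ S, ∑ _j ∈ L \ S.erase s, a = (L.card + 1 - S.card) • a := by
    intro s hs
    have hpos := Finset.card_pos.2 ⟨s, hs⟩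
    rw [Finset.sum_const, Finset.card_sdiff_of_subset ((S.erase_subset s).trans hSL),
      Finset.card_erase_of_mem hs]
    congr 1
    omega
  rw [Finset.sum_congr rfl hinner, Finset.sum_const, mul_smul]

/-- The exchange `(S, s, j) ↦ (S \ {s} ∪ {j}, j, s)` is an involution. -/
lemma sum_powersetCard_exchange {ι M : Type*} [DecidableEq ι] [AddCommMonoid M] (L : Finset ι)
    (k : ℕ) (f : Finset ι → M) :
    ∑ S ∈ L.powersetCard k, ∑ s ∈ S, ∑ j ∈ L \ S.erase s, f (insert j (S.erase s)) =
      (k * (L.card + 1 - k)) • ∑ S ∈ L.powersetCard k, f S := by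
  have hcount : ∀ S ∈ L.powersetCard k,
      ∑ s ∈ S, ∑ _j ∈ L \ S.erase s, f S = (k * (L.card + 1 - k)) • f S := by
    intro S hS
    obtain ⟨hSL, rfl⟩ := Finset.mem_powersetCard.1 hS
    exact sum_sum_sdiff_erase_const hSL (f S)
  rw [Finset.smul_sum, ← Finset.sum_congr rfl hcount]
  simp only [Finset.sum_sigma']
  set T := (L.powersetCard k).sigma fun S => S.sigma fun s => L \ S.erase s
  let swap : (Σ _ : Finset ι, Σ _ : ι, ι) → (Σ _ : Finset ι, Σ _ : ι, ι) :=
    fun x => ⟨insert x.2.2 (x.1.erase x.2.1), x.2.2, x.2.1⟩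
  have hT : ∀ S s j, (⟨S, s, j⟩ : Σ _ : Finset ι, Σ _ : ι, ι) ∈ T ↔
      (S ⊆ L ∧ S.card = k) ∧ s ∈ S ∧ j ∈ L ∧ j ∉ S.erase s := by
    intro S s j
    simp only [T, Finset.mem_sigma, Finset.mem_powersetCard, Finset.mem_sdiff]
  have hmaps : ∀ x ∈ T, swap x ∈ T := by
    rintro ⟨S, s, j⟩ hx
    obtain ⟨⟨hSL, hSk⟩, hs, hjL, hj⟩ := (hT S s j).1 hx
    refine (hT _ _ _).2 ⟨⟨?_, ?_⟩, Finset.mem_insert_self _ _, hSL hs, ?_⟩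
    · exact Finset.insert_subset hjL ((S.erase_subset s).trans hSL)
    · rw [Finset.card_insert_of_notMem hj, Finset.card_erase_add_one hs, hSk]
    · rw [Finset.erase_insert hj]
      exact Finset.notMem_erase s S
  have hinv : ∀ x ∈ T, swap (swap x) = x := by
    rintro ⟨S, s, j⟩ hx
    obtain ⟨-, hs, -, hj⟩ := (hT S s j).1 hx
    simp only [swap, Finset.erase_insert hj, Finset.insert_erase hs]
  exact Finset.sum_nbij' swap swap hmaps hmaps hinv hinv fun _ _ => rfl

section Expectation

lemma sum_pmf_toReal {α : Type*} [Fintype α] (μ : PMF α) : ∑ a, (μ a).toReal = 1 := by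
  rw [← ENNReal.toReal_sum fun a _ => μ.apply_ne_top a,
    ← tsum_fintype (L := .unconditional _), μ.tsum_coe, ENNReal.toReal_one]

lemma pmf_toReal_pos {α : Type*} {μ : PMF α} {a : α} (ha : a ∈ μ.support) : 0 < (μ a).toReal :=
  ENNReal.toReal_pos ((μ.mem_support_iff a).1 ha) (μ.apply_ne_top a)

lemma pmf_toReal_eq_zero {α : Type*} {μ : PMF α} {a : α} (ha : a ∉ μ.support) :
    (μ a).toReal = 0 := by
  rw [(μ.apply_eq_zero_iff a).2 ha, ENNReal.toReal_zero]

lemma pmf_toReal_mul_le {α : Type*} {μ : PMF α} {f g : α → ℝ} (h : ∀ a ∈ μ.support, f a ≤ g a)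
    (a : α) : (μ a).toReal * f a ≤ (μ a).toReal * g a := by
  by_cases ha : a ∈ μ.support
  · exact mul_le_mul_of_nonneg_left (h a ha) ENNReal.toReal_nonneg
  · rw [pmf_toReal_eq_zero ha, zero_mul, zero_mul]

variable {d : ℕ} {μ : PMF (Finset (Fin d))} {f g : Finset (Fin d) → ℝ}

lemma expectation_mono (h : ∀ S ∈ μ.support, f S ≤ g S) :
    expectation μ f ≤ expectation μ g :=
  Finset.sum_le_sum fun S _ => pmf_toReal_mul_le h S

lemma expectation_const_add_mul (μ : PMF (Finset (Fin d))) (f : Finset (Fin d) → ℝ) (a b : ℝ) :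
    expectation μ (fun S => a + b * f S) = a + b * expectation μ f := by
  simp only [expectation, mul_add, Finset.sum_add_distrib, ← Finset.sum_mul, sum_pmf_toReal,
    one_mul, mul_left_comm _ b, ← Finset.mul_sum]

lemma eq_of_expectation_eq_of_le (hle : ∀ S ∈ μ.support, f S ≤ g S)
    (heq : expectation μ f = expectation μ g) {S : Finset (Fin d)} (hS : S ∈ μ.support) :
    f S = g S :=
  mul_left_cancel₀ (pmf_toReal_pos hS).ne'
    ((Finset.sum_eq_sum_iff_of_le fun T _ => pmf_toReal_mul_le hle T).1 heq S
      (Finset.mem_univ S))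

end Expectation

section DPP

variable {d k : ℕ} {μ : PMF (Finset (Fin d))} {K : Matrix (Fin d) (Fin d) ℝ}
  {S T : Finset (Fin d)}

lemma IsDPP.sum_toReal_eq_principalMinor (h : IsDPP K μ) (S : Finset (Fin d)) :
    ∑ T with S ⊆ T, (μ T).toReal = principalMinor K S :=
  h S

lemma IsDPP.principalMinor_pos (h : IsDPP K μ) (hT : T ∈ μ.support) (hST : S ⊆ T) :
    0 < principalMinor K S := by
  rw [← h.sum_toReal_eq_principalMinor]
  exact Finset.sum_pos' (fun _ _ => ENNReal.toReal_nonneg)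
    ⟨T, Finset.mem_filter.2 ⟨Finset.mem_univ T, hST⟩, pmf_toReal_pos hT⟩

lemma IsDPP.card_le_rank (h : IsDPP K μ) (hS : S ∈ μ.support) : S.card ≤ K.rank := by
  by_contra! hlt
  exact (h.principalMinor_pos hS subset_rfl).ne' (principalMinor_eq_zero_of_rank_lt hlt)

lemma IsDPP.toReal_eq_principalMinor (h : IsDPP K μ) (hS : K.rank ≤ S.card) :
    (μ S).toReal = principalMinor K S := by
  rw [← h.sum_toReal_eq_principalMinor]
  symm
  refine Finset.sum_eq_single S (fun T hT hTS => ?_) fun hS => absurd (by simp) hS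
  have hST : S ⊂ T := (Finset.mem_filter.1 hT).2.ssubset_of_ne hTS.symm
  refine pmf_toReal_eq_zero fun hsupp => ?_
  exact (hS.trans_lt (Finset.card_lt_card hST)).not_ge (h.card_le_rank hsupp)

lemma IsDPP.expectation_card (h : IsDPP K μ) :
    expectation μ (fun S => (S.card : ℝ)) = K.trace := by
  calc expectation μ (fun S => (S.card : ℝ))
      = ∑ S : Finset (Fin d), ∑ i, if {i} ⊆ S then (μ S).toReal else 0 := by
        simp only [expectation, Finset.singleton_subset_iff, Finset.sum_ite_mem,
          Finset.univ_inter, Finset.sum_const, nsmul_eq_mul, mul_comm]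
    _ = ∑ i, ∑ S with {i} ⊆ S, (μ S).toReal := by
        rw [Finset.sum_comm]
        simp only [Finset.sum_filter]
    _ = K.trace := by
        simp only [h.sum_toReal_eq_principalMinor, principalMinor_singleton, trace, diag_apply]

lemma IsDPP.card_eq_rank (h : IsDPP K μ) (hK : K.trace = K.rank) (hS : S ∈ μ.support) :
    S.card = K.rank := by
  have hmean : expectation μ (fun S => (S.card : ℝ)) = expectation μ fun _ => (K.rank : ℝ) := by
    rw [h.expectation_card, hK]
    simpa using (expectation_const_add_mul μ 0 K.rank 0).symm
  exact_mod_cast eq_of_expectation_eq_of_le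
    (fun T hT => Nat.cast_le.2 (h.card_le_rank hT)) hmean hS

lemma rank_mul_transpose_of_isometry {W : Matrix (Fin d) (Fin k) ℝ} (hW : Wᵀ * W = 1) :
    (W * Wᵀ).rank = k := by
  rw [rank_self_mul_transpose, ← rank_transpose_mul_self, hW, rank_one, Fintype.card_fin]

lemma trace_mul_transpose_of_isometry {W : Matrix (Fin d) (Fin k) ℝ} (hW : Wᵀ * W = 1) :
    (W * Wᵀ).trace = k := by
  rw [trace_mul_comm, hW, trace_one, Fintype.card_fin]

variable {W : Matrix (Fin d) (Fin k) ℝ}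

lemma IsDPP.card_eq (h : IsDPP (W * Wᵀ) μ) (hW : Wᵀ * W = 1) (hS : S ∈ μ.support) :
    S.card = k := by
  have hrank := rank_mul_transpose_of_isometry hW
  have hcard := h.card_eq_rank (by rw [trace_mul_transpose_of_isometry hW, hrank]) hS
  exact hcard.trans hrank

lemma IsDPP.mul_obliqueProj (h : IsDPP (W * Wᵀ) μ) (hW : Wᵀ * W = 1) (hS : S ∈ μ.support) :
    W * Wᵀ * obliqueProj (W * Wᵀ) S = W * Wᵀ :=
  mul_transpose_mul_obliqueProj W ((h.card_eq hW hS).trans (Fintype.card_fin k).symm)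
    (h.principalMinor_pos hS subset_rfl).ne'.isUnit

lemma IsDPP.toReal_mul_frobNorm_obliqueProj_sq (h : IsDPP (W * Wᵀ) μ) (hW : Wᵀ * W = 1)
    (hS : S ∈ μ.support) :
    (μ S).toReal * frobNorm (obliqueProj (W * Wᵀ) S) ^ 2 =
      ∑ s ∈ S, ∑ j ∈ (S.erase s)ᶜ, (μ (insert j (S.erase s))).toReal := by
  have hcard := h.card_eq hW hS
  have hrank := rank_mul_transpose_of_isometry hW
  have hsymm : (W * Wᵀ)ᵀ = W * Wᵀ := by rw [transpose_mul, transpose_transpose]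
  rw [h.toReal_eq_principalMinor (hrank.trans hcard.symm).le, frobNorm_obliqueProj_sq, mul_comm,
    sum_obliqueCoeff_sq_mul_principalMinor hsymm (h.mul_obliqueProj hW hS)]
  refine Finset.sum_congr rfl fun s hs => Finset.sum_congr rfl fun j hj => ?_
  rw [h.toReal_eq_principalMinor]
  rw [Finset.card_insert_of_notMem (Finset.mem_compl.1 hj), Finset.card_erase_add_one hs, hrank,
    hcard]

lemma sparsity_eq_card (W : Matrix (Fin d) (Fin k) ℝ) :
    sparsity W = (Finset.univ.filter (leverageScore W · ≠ 0)).card := by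
  rw [sparsity, Set.ncard_eq_toFinset_card', Set.toFinset_ofPred]

lemma IsDPP.leverageScore_ne_zero (h : IsDPP (W * Wᵀ) μ) (hS : S ∈ μ.support) {i : Fin d}
    (hi : i ∈ S) : leverageScore W i ≠ 0 := by
  have hpos := h.principalMinor_pos hS (Finset.singleton_subset_iff.2 hi)
  rw [principalMinor_singleton, mul_apply] at hpos
  simpa only [leverageScore, sq, transpose_apply] using hpos.ne'

lemma IsDPP.support_subset_powersetCard (h : IsDPP (W * Wᵀ) μ) (hW : Wᵀ * W = 1)
    (hS : S ∈ μ.support) :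
    S ∈ (Finset.univ.filter (leverageScore W · ≠ 0)).powersetCard k :=
  Finset.mem_powersetCard.2 ⟨fun i hi => Finset.mem_filter.2
    ⟨Finset.mem_univ i, h.leverageScore_ne_zero hS hi⟩, h.card_eq hW hS⟩

lemma IsDPP.le_sparsity (h : IsDPP (W * Wᵀ) μ) (hW : Wᵀ * W = 1) : k ≤ sparsity W := by
  obtain ⟨S, hS⟩ := μ.support_nonempty
  obtain ⟨hSL, hSk⟩ := Finset.mem_powersetCard.1 (h.support_subset_powersetCard hW hS)
  exact hSk.ge.trans ((Finset.card_le_card hSL).trans (sparsity_eq_card W).ge)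

lemma IsDPP.toReal_mul_frobNorm_obliqueProj_sq_le (h : IsDPP (W * Wᵀ) μ) (hW : Wᵀ * W = 1)
    (S : Finset (Fin d)) :
    (μ S).toReal * frobNorm (obliqueProj (W * Wᵀ) S) ^ 2 ≤
      ∑ s ∈ S, ∑ j ∈ Finset.univ.filter (leverageScore W · ≠ 0) \ S.erase s,
        (μ (insert j (S.erase s))).toReal := by
  by_cases hS : S ∈ μ.support
  · rw [h.toReal_mul_frobNorm_obliqueProj_sq hW hS]
    refine Finset.sum_le_sum fun s _ => (Finset.sum_subset ?_ fun j hj hjL => ?_).ge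
    · exact fun j hj => Finset.mem_compl.2 (Finset.mem_sdiff.1 hj).2
    · refine pmf_toReal_eq_zero fun hμ => hjL (Finset.mem_sdiff.2 ⟨?_, Finset.mem_compl.1 hj⟩)
      exact Finset.mem_filter.2
        ⟨Finset.mem_univ j, h.leverageScore_ne_zero hμ (Finset.mem_insert_self _ _)⟩
  · rw [pmf_toReal_eq_zero hS, zero_mul]
    positivity

lemma IsDPP.expectation_frobNorm_obliqueProj_sq_le (h : IsDPP (W * Wᵀ) μ) (hW : Wᵀ * W = 1) :
    expectation μ (fun S => frobNorm (obliqueProj (W * Wᵀ) S) ^ 2) ≤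
      k + k * ((sparsity W : ℝ) - k) := by
  set L := Finset.univ.filter (leverageScore W · ≠ 0)
  have hsupp : ∀ S ∉ L.powersetCard k, (μ S).toReal = 0 := fun S hS =>
    pmf_toReal_eq_zero fun hμ => hS (h.support_subset_powersetCard hW hμ)
  have hmass : ∑ S ∈ L.powersetCard k, (μ S).toReal = 1 := by
    rw [← sum_pmf_toReal μ]
    exact Finset.sum_subset (Finset.subset_univ _) fun S _ hS => hsupp S hS
  calc expectation μ (fun S => frobNorm (obliqueProj (W * Wᵀ) S) ^ 2)
      = ∑ S ∈ L.powersetCard k, (μ S).toReal * frobNorm (obliqueProj (W * Wᵀ) S) ^ 2 :=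
        (Finset.sum_subset (Finset.subset_univ _) fun S _ hS => by rw [hsupp S hS, zero_mul]).symm
    _ ≤ (k * (L.card + 1 - k)) • ∑ S ∈ L.powersetCard k, (μ S).toReal :=
        (Finset.sum_le_sum fun S _ => h.toReal_mul_frobNorm_obliqueProj_sq_le hW S).trans
          (sum_powersetCard_exchange L k fun S => (μ S).toReal).le
    _ = k + k * ((sparsity W : ℝ) - k) := by
        rw [hmass, ← sparsity_eq_card, nsmul_eq_mul, mul_one, Nat.cast_mul,
          Nat.cast_sub ((h.le_sparsity hW).trans (Nat.le_succ _))]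
        push_cast
        ring

end DPP

section ColumnSelection

variable {N d k : ℕ} {μ : PMF (Finset (Fin d))} {W : Matrix (Fin d) (Fin k) ℝ}
  {S : Finset (Fin d)}

lemma mul_obliqueProj_mem_colSpanRankLE (X : Matrix (Fin N) (Fin d) ℝ)
    (K : Matrix (Fin d) (Fin d) ℝ) (hS : S.card = k) :
    X * obliqueProj K S ∈ colSpanRankLE X S k :=
  ⟨obliqueCoeff K S,
    (rank_le_card_height _).trans_eq ((Fintype.card_coe S).trans hS), mul_obliqueProj_eq X K S⟩

lemma IsBestApprox.sq_le_sq {ν : Matrix (Fin N) (Fin d) ℝ → ℝ} (hν : ∀ A, 0 ≤ ν A)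
    {X A B : Matrix (Fin N) (Fin d) ℝ} {𝒜 : Set (Matrix (Fin N) (Fin d) ℝ)}
    (h : IsBestApprox ν X 𝒜 A) (hB : B ∈ 𝒜) : ν (X - A) ^ 2 ≤ ν (X - B) ^ 2 :=
  pow_le_pow_left₀ (hν _) (h.2 B hB) 2

lemma IsDPP.expectation_le_of_le_frobNorm_obliqueProj_sq (h : IsDPP (W * Wᵀ) μ)
    (hW : Wᵀ * W = 1) {F : Finset (Fin d) → ℝ} {a b : ℝ} (hb : 0 ≤ b)
    (hF : ∀ S ∈ μ.support, F S ≤ a + b * (frobNorm (obliqueProj (W * Wᵀ) S) ^ 2 - k)) :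
    expectation μ F ≤ a + b * (k * ((sparsity W : ℝ) - k)) := by
  have hmean := mul_le_mul_of_nonneg_left (h.expectation_frobNorm_obliqueProj_sq_le hW) hb
  calc expectation μ F
      ≤ expectation μ (fun S => (a - b * k) + b * frobNorm (obliqueProj (W * Wᵀ) S) ^ 2) :=
        expectation_mono fun S hS => (hF S hS).trans_eq (by ring)
    _ = (a - b * k) + b * expectation μ (fun S => frobNorm (obliqueProj (W * Wᵀ) S) ^ 2) :=
        expectation_const_add_mul _ _ _ _
    _ ≤ a + b * (k * ((sparsity W : ℝ) - k)) := by linarith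

lemma IsDPP.oblique_identities (h : IsDPP (W * Wᵀ) μ) (hW : Wᵀ * W = 1) (hS : S ∈ μ.support) :
    (W * Wᵀ)ᵀ = W * Wᵀ ∧ W * Wᵀ * obliqueProj (W * Wᵀ) S = W * Wᵀ ∧
      obliqueProj (W * Wᵀ) S * (W * Wᵀ) = obliqueProj (W * Wᵀ) S := by
  refine ⟨by rw [transpose_mul, transpose_transpose], h.mul_obliqueProj hW hS,
    obliqueProj_mul ?_ S⟩
  rw [Matrix.mul_assoc, ← Matrix.mul_assoc Wᵀ, hW, Matrix.one_mul]

theorem IsDPP.expectation_specNorm_sub_sq_le (h : IsDPP (W * Wᵀ) μ) (hW : Wᵀ * W = 1)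
    {X : Matrix (Fin N) (Fin d) ℝ} {PS : Finset (Fin d) → Matrix (Fin N) (Fin d) ℝ}
    (hPS : ∀ S : Finset (Fin d), S.card = k →
      IsBestApprox specNorm X (colSpanRankLE X S k) (PS S)) :
    expectation μ (fun S => specNorm (X - PS S) ^ 2) ≤ specNorm (X - X * (W * Wᵀ)) ^ 2 +
      specNorm (X - X * (W * Wᵀ)) ^ 2 * (k * ((sparsity W : ℝ) - k)) := by
  refine h.expectation_le_of_le_frobNorm_obliqueProj_sq hW (sq_nonneg _) fun S hS => ?_
  obtain ⟨hsymm, hKP, hPK⟩ := h.oblique_identities hW hS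
  have hcard := h.card_eq hW hS
  rw [← trace_mul_transpose_of_isometry hW]
  exact ((hPS S hcard).sq_le_sq specNorm_nonneg
    (mul_obliqueProj_mem_colSpanRankLE X _ hcard)).trans
      (specNorm_sub_mul_oblique_sq_le hsymm hKP hPK X)

theorem IsDPP.expectation_frobNorm_sub_sq_le (h : IsDPP (W * Wᵀ) μ) (hW : Wᵀ * W = 1)
    {X : Matrix (Fin N) (Fin d) ℝ} {PS : Finset (Fin d) → Matrix (Fin N) (Fin d) ℝ}
    (hPS : ∀ S : Finset (Fin d), S.card = k →
      IsBestApprox frobNorm X (colSpanRankLE X S k) (PS S)) :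
    expectation μ (fun S => frobNorm (X - PS S) ^ 2) ≤ frobNorm (X - X * (W * Wᵀ)) ^ 2 +
      specNorm (X - X * (W * Wᵀ)) ^ 2 * (k * ((sparsity W : ℝ) - k)) := by
  refine h.expectation_le_of_le_frobNorm_obliqueProj_sq hW (sq_nonneg _) fun S hS => ?_
  obtain ⟨hsymm, hKP, hPK⟩ := h.oblique_identities hW hS
  have hcard := h.card_eq hW hS
  rw [← trace_mul_transpose_of_isometry hW]
  exact ((hPS S hcard).sq_le_sq frobNorm_nonneg
    (mul_obliqueProj_mem_colSpanRankLE X _ hcard)).trans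
      (frobNorm_sub_mul_oblique_sq_le hsymm hKP hPK X)

end ColumnSelection

section SVD

variable {N d r k : ℕ}

lemma singVal_of_lt (σ : Fin r → ℝ) {i : ℕ} (h : i < r) : singVal σ i = σ ⟨i, h⟩ :=
  dif_pos h

lemma singVal_of_ge (σ : Fin r → ℝ) {i : ℕ} (h : r ≤ i) : singVal σ i = 0 :=
  dif_neg h.not_gt

lemma singVal_val (σ : Fin r → ℝ) (j : Fin r) : singVal σ j = σ j :=
  singVal_of_lt σ j.2

lemma firstCols_transpose_mul_self {V : Matrix (Fin d) (Fin r) ℝ} (hV : Vᵀ * V = 1) (hk : k ≤ r) :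
    (firstCols V k hk)ᵀ * firstCols V k hk = 1 := by
  change (Vᵀ * V).submatrix (Fin.castLE hk) (Fin.castLE hk) = 1
  rw [hV, submatrix_one _ (Fin.castLE_injective hk)]

lemma firstCols_mul_transpose (V : Matrix (Fin d) (Fin r) ℝ) (hk : k ≤ r) :
    firstCols V k hk * (firstCols V k hk)ᵀ =
      V * diagonal (fun j : Fin r => if (j : ℕ) < k then (1 : ℝ) else 0) * Vᵀ := by
  ext a b
  simp only [mul_apply (M := firstCols V k hk), mul_apply (N := Vᵀ), mul_diagonal,
    transpose_apply]
  refine Finset.sum_of_injOn (Fin.castLE hk) (Fin.castLE_injective hk).injOn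
    (fun _ _ => Finset.mem_coe.2 (Finset.mem_univ _)) (fun j _ hj => ?_) fun i _ => ?_
  · rw [if_neg fun hjk => hj ⟨⟨j, hjk⟩, by simp, rfl⟩, mul_zero, zero_mul]
  · rw [Fin.val_castLE, if_pos i.2, mul_one]
    rfl

variable {X : Matrix (Fin N) (Fin d) ℝ} {U : Matrix (Fin N) (Fin r) ℝ} {σ : Fin r → ℝ}
  {V : Matrix (Fin d) (Fin r) ℝ}

lemma IsSVD.rank_le (h : IsSVD X U σ V) : r ≤ d := by
  have hV : V.rank = r := by
    rw [← rank_transpose_mul_self, h.right_orthonormal, rank_one, Fintype.card_fin]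
  simpa only [hV, Fintype.card_fin] using V.rank_le_card_height

lemma IsSVD.singVal_antitone (h : IsSVD X U σ V) : Antitone (singVal σ) := by
  intro i j hij
  unfold singVal
  split_ifs with hj hi
  · exact h.antitone hij
  · exact absurd (hij.trans_lt hj) hi
  · exact (h.pos _).le
  · exact le_rfl

lemma IsSVD.singVal_nonneg (h : IsSVD X U σ V) (i : ℕ) : 0 ≤ singVal σ i :=
  (singVal_of_ge σ (le_max_left r i)).ge.trans (h.singVal_antitone (le_max_right r i))

lemma IsSVD.sub_mul_firstCols (h : IsSVD X U σ V) (hk : k ≤ r) :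
    X - X * (firstCols V k hk * (firstCols V k hk)ᵀ) =
      U * (diagonal (fun j : Fin r => if (j : ℕ) < k then 0 else σ j) * Vᵀ) := by
  have hdiag : diagonal (fun j : Fin r => if (j : ℕ) < k then 0 else σ j) =
      diagonal σ - diagonal σ * diagonal (fun j : Fin r => if (j : ℕ) < k then (1 : ℝ) else 0) := by
    rw [diagonal_mul_diagonal, diagonal_sub]
    congr 1
    ext j
    split_ifs <;> simp
  calc X - X * (firstCols V k hk * (firstCols V k hk)ᵀ)
      = U * diagonal σ * Vᵀ - U * diagonal σ * (Vᵀ * V) *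
          diagonal (fun j : Fin r => if (j : ℕ) < k then (1 : ℝ) else 0) * Vᵀ := by
        rw [firstCols_mul_transpose, h.eq_mul]
        simp only [Matrix.mul_assoc]
    _ = _ := by
        rw [h.right_orthonormal, hdiag, Matrix.mul_one, Matrix.sub_mul, Matrix.mul_sub]
        simp only [Matrix.mul_assoc]

lemma IsSVD.specNorm_sub_mul_firstCols_le (h : IsSVD X U σ V) (hk : k ≤ r) :
    specNorm (X - X * (firstCols V k hk * (firstCols V k hk)ᵀ)) ≤ singVal σ k := by
  rw [h.sub_mul_firstCols, specNorm_mul_left_isometry h.left_orthonormal, ← specNorm_transpose,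
    transpose_mul, transpose_transpose, specNorm_mul_left_isometry h.right_orthonormal,
    diagonal_transpose, specNorm_diagonal]
  refine (pi_norm_le_iff_of_nonneg (h.singVal_nonneg k)).2 fun j => ?_
  split_ifs with hj
  · exact norm_zero.trans_le (h.singVal_nonneg k)
  · rw [Real.norm_of_nonneg (h.pos j).le, ← singVal_val σ j]
    exact h.singVal_antitone (not_lt.1 hj)

lemma sum_Ico_singVal_sq (hrd : r ≤ d) (σ : Fin r → ℝ) :
    ∑ j ∈ Finset.Ico k d, singVal σ j ^ 2 =
      ∑ j : Fin r with ¬ j.val < k, σ j ^ 2 := by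
  symm
  refine Finset.sum_of_injOn Fin.val Fin.val_injective.injOn (fun j hj => ?_)
    (fun i hi hir => ?_) fun j _ => by rw [singVal_val]
  · have hkj := (Finset.mem_filter.1 (Finset.mem_coe.1 hj)).2
    exact Finset.mem_coe.2 (Finset.mem_Ico.2 ⟨not_lt.1 hkj, j.2.trans_le hrd⟩)
  · have hri : r ≤ i := by
      by_contra! hlt
      exact hir ⟨⟨i, hlt⟩, by simpa using (Finset.mem_Ico.1 hi).1, rfl⟩
    rw [singVal_of_ge σ hri, zero_pow two_ne_zero]

lemma IsSVD.frobNorm_sub_mul_firstCols_sq (h : IsSVD X U σ V) (hk : k ≤ r) :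
    frobNorm (X - X * (firstCols V k hk * (firstCols V k hk)ᵀ)) ^ 2 =
      ∑ j ∈ Finset.Ico k d, singVal σ j ^ 2 := by
  rw [h.sub_mul_firstCols, frobNorm_mul_left_isometry h.left_orthonormal, ← frobNorm_transpose,
    transpose_mul, transpose_transpose, frobNorm_mul_left_isometry h.right_orthonormal,
    frobNorm_sq_eq_trace, transpose_transpose, diagonal_transpose, diagonal_mul_diagonal,
    trace_diagonal, sum_Ico_singVal_sq h.rank_le, Finset.sum_filter]
  refine Finset.sum_congr rfl fun j _ => ?_
  split_ifs
  · rw [mul_zero]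
  · rw [sq]

lemma IsSVD.flatness_nonneg (h : IsSVD X U σ V) (hk : k ≤ r) : 0 ≤ flatness d k σ := by
  have hkd : (0 : ℝ) ≤ d - k := sub_nonneg.2 (Nat.cast_le.2 (hk.trans h.rank_le))
  unfold flatness
  positivity

lemma IsSVD.flatness_mul (h : IsSVD X U σ V) (hk : k ≤ r) (q : ℝ) :
    flatness d k σ * (q / ((d : ℝ) - k)) * ∑ j ∈ Finset.Ico k d, singVal σ j ^ 2 =
      singVal σ k ^ 2 * q := by
  rcases hk.eq_or_lt with rfl | hkr
  · simp [flatness, singVal_of_ge σ le_rfl]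
  · have hkd : (0 : ℝ) < d - k := sub_pos.2 (Nat.cast_lt.2 (hkr.trans_le h.rank_le))
    have htail : 0 < ∑ j ∈ Finset.Ico k d, singVal σ j ^ 2 := by
      refine Finset.sum_pos' (fun _ _ => sq_nonneg _)
        ⟨k, Finset.mem_Ico.2 ⟨le_rfl, hkr.trans_le h.rank_le⟩, ?_⟩
      rw [singVal_of_lt σ hkr]
      exact pow_pos (h.pos _) 2
    rw [flatness]
    field_simp

end SVD

section EckartYoung

lemma exists_ne_zero_mulVec_eq_zero_of_rank_lt {m ι R : Type*} [Fintype ι] [Field R]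
    {B : Matrix m ι R} (h : B.rank < Fintype.card ι) : ∃ z : ι → R, z ≠ 0 ∧ B *ᵥ z = 0 := by
  have hker : B.mulVecLin.ker ≠ ⊥ := by
    intro hbot
    refine h.ne ?_
    rw [Matrix.rank, LinearMap.finrank_range_of_inj (LinearMap.ker_eq_bot.1 hbot),
      Module.finrank_fintype_fun_eq_card]
  obtain ⟨z, hz, hz0⟩ := (Submodule.ne_bot_iff _).1 hker
  exact ⟨z, hz0, hz⟩

lemma mulVec_dotProduct_mulVec_of_isometry {ι κ R : Type*} [Fintype ι] [Fintype κ] [DecidableEq κ]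
    [CommRing R] {U : Matrix ι κ R} (hU : Uᵀ * U = 1) (z : κ → R) :
    (U *ᵥ z) ⬝ᵥ (U *ᵥ z) = z ⬝ᵥ z := by
  rw [dotProduct_mulVec, vecMul_mulVec, hU, vecMul_one]

section

variable {N d r k : ℕ} {X : Matrix (Fin N) (Fin d) ℝ} {U : Matrix (Fin N) (Fin r) ℝ}
  {σ : Fin r → ℝ} {V : Matrix (Fin d) (Fin r) ℝ}

lemma IsSVD.mul_firstCols (h : IsSVD X U σ V) (hk : k ≤ r) :
    X * firstCols V k hk = firstCols U k hk * diagonal (σ ∘ Fin.castLE hk) := by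
  have hXV : X * V = U * diagonal σ := by
    rw [h.eq_mul, Matrix.mul_assoc, h.right_orthonormal, Matrix.mul_one]
  ext i j
  rw [mul_diagonal]
  exact (congrFun (congrFun hXV i) (Fin.castLE hk j)).trans (mul_diagonal _ _ _ _)

lemma IsSVD.singVal_le_specNorm_sub_of_rank_le (h : IsSVD X U σ V)
    {A : Matrix (Fin N) (Fin d) ℝ} (hA : A.rank ≤ k) : singVal σ k ≤ specNorm (X - A) := by
  obtain hrk | hkr := le_or_gt r k
  · rw [singVal_of_ge σ hrk]
    exact specNorm_nonneg _
  set W := firstCols V (k + 1) hkr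
  obtain ⟨z, hz, hAz⟩ : ∃ z : Fin (k + 1) → ℝ, z ≠ 0 ∧ (A * W) *ᵥ z = 0 := by
    refine exists_ne_zero_mulVec_eq_zero_of_rank_lt ?_
    rw [Fintype.card_fin]
    exact Nat.lt_succ_of_le ((rank_mul_le_left A W).trans hA)
  have hXz : (X - A) *ᵥ (W *ᵥ z) =
      firstCols U (k + 1) hkr *ᵥ (diagonal (σ ∘ Fin.castLE hkr) *ᵥ z) := by
    rw [mulVec_mulVec, Matrix.sub_mul, sub_mulVec, hAz, sub_zero, h.mul_firstCols, mulVec_mulVec]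
  have hlow : singVal σ k ^ 2 * (z ⬝ᵥ z) ≤ ((X - A) *ᵥ (W *ᵥ z)) ⬝ᵥ ((X - A) *ᵥ (W *ᵥ z)) := by
    rw [hXz, mulVec_dotProduct_mulVec_of_isometry
      (firstCols_transpose_mul_self h.left_orthonormal hkr), dotProduct, Finset.mul_sum]
    refine Finset.sum_le_sum fun j _ => ?_
    have hj : singVal σ k ≤ σ (Fin.castLE hkr j) :=
      (h.singVal_antitone (Nat.le_of_lt_succ j.2)).trans_eq (singVal_val σ (Fin.castLE hkr j))
    rw [mulVec_diagonal, Function.comp_apply, mul_mul_mul_comm, ← sq (σ _)]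
    exact mul_le_mul_of_nonneg_right (pow_le_pow_left₀ (h.singVal_nonneg k) hj 2)
      (mul_self_nonneg _)
  have hupp := mulVec_dotProduct_mulVec_le (X - A) (W *ᵥ z)
  rw [mulVec_dotProduct_mulVec_of_isometry
    (firstCols_transpose_mul_self h.right_orthonormal hkr)] at hupp
  have hzz : 0 < z ⬝ᵥ z := (Finset.sum_nonneg fun j _ => mul_self_nonneg (z j)).lt_of_ne'
    (dotProduct_self_eq_zero.not.2 hz)
  exact le_of_sq_le_sq (le_of_mul_le_mul_right (hlow.trans hupp) hzz) (specNorm_nonneg _)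

end

lemma exists_isStarProjection_mul_eq_self {m n : Type*} [Finite m] [Fintype n]
    (A : Matrix m n ℝ) : ∃ P : Matrix n n ℝ, IsStarProjection P ∧ A * P = A ∧ P.trace = A.rank := by
  classical
  cases nonempty_fintype m
  let toCLM := toEuclideanCLM (𝕜 := ℝ) (n := n)
  set p := (toEuclideanLin A).kerᗮ
  have hp : IsStarProjection p.starProjection := isStarProjection_starProjection
  set P := toCLM.symm p.starProjection
  have hP (x : EuclideanSpace ℝ n) : toEuclideanLin P x = p.starProjection x :=
    congrArg (· x) (toCLM.apply_symm_apply p.starProjection)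
  refine ⟨P, ⟨?_, ?_⟩, ?_, ?_⟩
  · exact (map_mul toCLM.symm _ _).symm.trans (congrArg toCLM.symm hp.isIdempotentElem)
  · exact (toCLM.symm.map_star' _).symm.trans (congrArg toCLM.symm hp.isSelfAdjoint)
  · refine toEuclideanLin.injective (LinearMap.ext fun x => ?_)
    have hker : toEuclideanLin A (x - toEuclideanLin P x) = 0 := by
      rw [hP]
      have := p.sub_starProjection_mem_orthogonal x
      rwa [Submodule.orthogonal_orthogonal] at this
    rw [map_sub, sub_eq_zero] at hker
    rw [hker]
    simp [toLpLin_apply]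
  · have hproj : LinearMap.IsProj p (toEuclideanLin P) :=
      ⟨fun x => hP x ▸ p.starProjection_apply_mem x,
        fun x hx => (hP x).trans (Submodule.starProjection_eq_self_iff.2 hx)⟩
    have htrace : P.trace = Module.finrank ℝ p := by
      rw [← hproj.trace, toEuclideanLin_eq_toLin_orthonormal, trace_toLin_eq]
    have hrank : A.rank = Module.finrank ℝ (toEuclideanLin A).range := by
      rw [toEuclideanLin_eq_toLin_orthonormal]
      exact A.rank_eq_finrank_range_toLin _ _
    have hrange := (toEuclideanLin A).finrank_range_add_finrank_ker
    have horth := (toEuclideanLin A).ker.finrank_add_finrank_orthogonal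
    rw [htrace, hrank, Nat.cast_inj]
    exact Nat.add_left_cancel (horth.trans (hrange.symm.trans (Nat.add_comm _ _)))

lemma posSemidef_of_isStarProjection {n : Type*} [Fintype n] {P : Matrix n n ℝ}
    (hP : IsStarProjection P) : P.PosSemidef := by
  open scoped MatrixOrder in exact nonneg_iff_posSemidef.1 hP.nonneg

lemma trace_transpose_mul_mul_le_trace {n κ : Type*} [Fintype n] [Fintype κ] [DecidableEq κ]
    {P : Matrix n n ℝ} (hP : P.PosSemidef) {V : Matrix n κ ℝ} (hV : Vᵀ * V = 1) :
    (Vᵀ * P * V).trace ≤ P.trace := by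
  classical
  set Q := 1 - V * Vᵀ
  have hQt : Qᴴ = Q := by
    rw [conjTranspose_eq_transpose_of_trivial, transpose_sub, transpose_one, transpose_mul,
      transpose_transpose]
  have hQQ : Q * Q = Q := by
    refine IsIdempotentElem.one_sub ?_
    rw [IsIdempotentElem, Matrix.mul_assoc, ← Matrix.mul_assoc Vᵀ, hV, Matrix.one_mul]
  have hnonneg : 0 ≤ (Qᴴ * P * Q).trace := (hP.conjTranspose_mul_mul_same Q).trace_nonneg
  have htrace : (Qᴴ * P * Q).trace = P.trace - (Vᵀ * P * V).trace := by
    rw [hQt, Matrix.mul_assoc, trace_mul_comm, Matrix.mul_assoc, hQQ, Matrix.mul_sub, trace_sub,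
      Matrix.mul_one, ← Matrix.mul_assoc, trace_mul_comm, Matrix.mul_assoc]
  linarith

lemma sum_mul_le_sum_of_threshold {ι R : Type*} [Fintype ι] [CommRing R] [LinearOrder R]
    [IsStrictOrderedRing R] {s : Finset ι} {a c : ι → R} {t : R} (ht : 0 ≤ t)
    (hs : ∀ i ∈ s, t ≤ a i) (hsc : ∀ i ∉ s, a i ≤ t) (hc₀ : ∀ i, 0 ≤ c i) (hc₁ : ∀ i, c i ≤ 1)
    (hsum : ∑ i, c i ≤ s.card) : ∑ i, a i * c i ≤ ∑ i ∈ s, a i := by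
  classical
  have hterm : ∀ i, a i * c i ≤ (if i ∈ s then a i - t else 0) + t * c i := by
    intro i
    split_ifs with hi
    · linarith [mul_le_of_le_one_right (sub_nonneg.2 (hs i hi)) (hc₁ i), sub_mul (a i) t (c i)]
    · linarith [mul_le_mul_of_nonneg_right (hsc i hi) (hc₀ i)]
  calc ∑ i, a i * c i
      ≤ ∑ i, ((if i ∈ s then a i - t else 0) + t * c i) := Finset.sum_le_sum fun i _ => hterm i
    _ = ∑ i ∈ s, a i - s.card * t + t * ∑ i, c i := by
        rw [Finset.sum_add_distrib, Finset.sum_ite_mem, Finset.univ_inter,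
          Finset.sum_sub_distrib, Finset.sum_const, nsmul_eq_mul, Finset.mul_sum]
    _ ≤ ∑ i ∈ s, a i := by linarith [mul_le_mul_of_nonneg_left hsum ht]

variable {N d r k : ℕ} {X : Matrix (Fin N) (Fin d) ℝ} {U : Matrix (Fin N) (Fin r) ℝ}
  {σ : Fin r → ℝ} {V : Matrix (Fin d) (Fin r) ℝ} {P : Matrix (Fin d) (Fin d) ℝ}

lemma frobNorm_mul_isStarProjection_sq_le (hP : IsStarProjection P)
    (M : Matrix (Fin N) (Fin d) ℝ) : frobNorm (M * P) ^ 2 ≤ frobNorm M ^ 2 := by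
  have hnorm : specNorm P ≤ 1 := by
    open scoped Matrix.Norms.L2Operator in exact hP.norm_le
  rw [← frobNorm_transpose, transpose_mul, ← frobNorm_transpose M]
  refine (frobNorm_mul_sq_le _ _).trans (mul_le_of_le_one_left (sq_nonneg _) ?_)
  rw [specNorm_transpose]
  exact pow_le_one₀ (specNorm_nonneg P) hnorm

lemma IsSVD.frobNorm_mul_isStarProjection_sq (h : IsSVD X U σ V) (hP : IsStarProjection P) :
    frobNorm (X * P) ^ 2 = ∑ j, σ j ^ 2 * (Vᵀ * P * V) j j := by
  have hPt : P * Pᵀ = P :=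
    (congrArg (P * ·) hP.isSelfAdjoint).trans hP.isIdempotentElem
  have hgram : diagonal σ * (Vᵀ * P) * (diagonal σ * (Vᵀ * P))ᵀ =
      diagonal σ * (Vᵀ * P * V) * diagonal σ := by
    nth_rw 3 [← hPt]
    simp only [transpose_mul, transpose_transpose, diagonal_transpose, Matrix.mul_assoc]
  rw [h.eq_mul, Matrix.mul_assoc, Matrix.mul_assoc, frobNorm_mul_left_isometry h.left_orthonormal,
    frobNorm_sq_eq_trace, hgram, trace]
  refine Finset.sum_congr rfl fun j _ => ?_
  rw [diag_apply, mul_diagonal, diagonal_mul]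
  ring

lemma IsSVD.diag_one_sub (h : IsSVD X U σ V) (P : Matrix (Fin d) (Fin d) ℝ) (j : Fin r) :
    (Vᵀ * (1 - P : Matrix (Fin d) (Fin d) ℝ) * V) j j = 1 - (Vᵀ * P * V) j j := by
  rw [Matrix.mul_sub, Matrix.sub_mul, Matrix.mul_one, h.right_orthonormal, Matrix.sub_apply,
    one_apply_eq]

lemma IsSVD.sum_sq_mul_diag_le (h : IsSVD X U σ V) (hk : k ≤ r) (hP : IsStarProjection P)
    (htrace : P.trace ≤ k) :
    ∑ j, σ j ^ 2 * (Vᵀ * P * V) j j ≤ ∑ j : Fin r with j.val < k, σ j ^ 2 := by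
  have hdiag {Q : Matrix (Fin d) (Fin d) ℝ} (hQ : IsStarProjection Q) (j : Fin r) :
      0 ≤ (Vᵀ * Q * V) j j :=
    ((posSemidef_of_isStarProjection hQ).conjTranspose_mul_mul_same V).diag_nonneg
  refine sum_mul_le_sum_of_threshold (sq_nonneg (singVal σ k)) (fun j hj => ?_) (fun j hj => ?_)
    (hdiag hP) (fun j => ?_) ?_
  · rw [← singVal_val σ j]
    exact pow_le_pow_left₀ (h.singVal_nonneg _)
      (h.singVal_antitone (Finset.mem_filter.1 hj).2.le) 2
  · rw [← singVal_val σ j]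
    exact pow_le_pow_left₀ (h.singVal_nonneg _) (h.singVal_antitone (by simpa using hj)) 2
  · exact sub_nonneg.1 ((hdiag hP.one_sub j).trans_eq (h.diag_one_sub P j))
  · rw [Fin.card_filter_val_lt, min_eq_right hk]
    exact (trace_transpose_mul_mul_le_trace (posSemidef_of_isStarProjection hP)
      h.right_orthonormal).trans htrace

lemma IsSVD.sum_singVal_sq_le_frobNorm_sub_sq_of_rank_le (h : IsSVD X U σ V) (hk : k ≤ r)
    {A : Matrix (Fin N) (Fin d) ℝ} (hA : A.rank ≤ k) :
    ∑ j ∈ Finset.Ico k d, singVal σ j ^ 2 ≤ frobNorm (X - A) ^ 2 := by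
  obtain ⟨P, hP, hAP, htrace⟩ := exists_isStarProjection_mul_eq_self A
  have hkept := h.sum_sq_mul_diag_le hk hP (htrace.trans_le (Nat.cast_le.2 hA))
  have hsplit := Finset.sum_filter_add_sum_filter_not Finset.univ (·.val < k) (σ · ^ 2)
  calc ∑ j ∈ Finset.Ico k d, singVal σ j ^ 2
      = ∑ j, σ j ^ 2 - ∑ j : Fin r with j.val < k, σ j ^ 2 := by
        rw [sum_Ico_singVal_sq h.rank_le, ← hsplit, add_sub_cancel_left]
    _ ≤ ∑ j, σ j ^ 2 - ∑ j, σ j ^ 2 * (Vᵀ * P * V) j j := sub_le_sub_left hkept _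
    _ = ∑ j, σ j ^ 2 * (Vᵀ * (1 - P : Matrix (Fin d) (Fin d) ℝ) * V) j j := by
        simp only [h.diag_one_sub, mul_sub, mul_one, Finset.sum_sub_distrib]
    _ = frobNorm ((X - A) * (1 - P)) ^ 2 := by
        rw [← h.frobNorm_mul_isStarProjection_sq hP.one_sub, Matrix.sub_mul X A,
          Matrix.mul_sub A, Matrix.mul_one, hAP, sub_self, sub_zero]
    _ ≤ frobNorm (X - A) ^ 2 := frobNorm_mul_isStarProjection_sq_le hP.one_sub _

end EckartYoung

theorem mainTheorem2 {N d r k : ℕ} (hk : k ≤ r)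
    (X : Matrix (Fin N) (Fin d) ℝ) (U : Matrix (Fin N) (Fin r) ℝ) (σ : Fin r → ℝ)
    (V : Matrix (Fin d) (Fin r) ℝ) (hX : IsSVD X U σ V)
    -- the law of the random subset `S`: the projection DPP of marginal kernel `V_k V_kᵀ`
    (μ : PMF (Finset (Fin d)))
    (hμ : IsDPP (firstCols V k hk * (firstCols V k hk).transpose) μ)
    -- `Π_S^2 X`, `Π_S^Fr X` for `|S| = k`
    (PS₂ PSF : Finset (Fin d) → Matrix (Fin N) (Fin d) ℝ)
    (hPS₂ : ∀ S : Finset (Fin d), S.card = k →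
      IsBestApprox specNorm X (colSpanRankLE X S k) (PS₂ S))
    (hPSF : ∀ S : Finset (Fin d), S.card = k →
      IsBestApprox frobNorm X (colSpanRankLE X S k) (PSF S))
    -- `Π_k X`, in the spectral and in the Frobenius sense
    (Pk₂ PkF : Matrix (Fin N) (Fin d) ℝ)
    (hPk₂ : IsBestApprox specNorm X (rankLE N d k) Pk₂)
    (hPkF : IsBestApprox frobNorm X (rankLE N d k) PkF) :
    expectation μ (fun S => specNorm (X - PS₂ S) ^ 2) ≤
        (1 + (k : ℝ) * ((sparsity (firstCols V k hk) : ℝ) - (k : ℝ))) *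
          specNorm (X - Pk₂) ^ 2 ∧
      expectation μ (fun S => frobNorm (X - PSF S) ^ 2) ≤
        (1 + flatness d k σ * (((sparsity (firstCols V k hk) : ℝ) - (k : ℝ)) /
            ((d : ℝ) - (k : ℝ))) * (k : ℝ)) *
          frobNorm (X - PkF) ^ 2 := by
  have hW := firstCols_transpose_mul_self hX.right_orthonormal hk
  have hp : (0 : ℝ) ≤ (sparsity (firstCols V k hk) : ℝ) - k :=
    sub_nonneg.2 (Nat.cast_le.2 (hμ.le_sparsity hW))
  have hd : (0 : ℝ) ≤ (d : ℝ) - k := sub_nonneg.2 (Nat.cast_le.2 (hk.trans hX.rank_le))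
  have hβ := hX.flatness_nonneg hk
  have hspec := hX.specNorm_sub_mul_firstCols_le hk
  have hfrob := hX.frobNorm_sub_mul_firstCols_sq hk
  constructor
  · have hopt := hspec.trans (hX.singVal_le_specNorm_sub_of_rank_le hPk₂.1)
    refine (hμ.expectation_specNorm_sub_sq_le hW hPS₂).trans ?_
    rw [← mul_one_add, mul_comm]
    gcongr
    exact specNorm_nonneg _
  · have hopt := hX.sum_singVal_sq_le_frobNorm_sub_sq_of_rank_le hk hPkF.1
    have hflat := hX.flatness_mul hk ((sparsity (firstCols V k hk) : ℝ) - k)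
    refine (hμ.expectation_frobNorm_sub_sq_le hW hPSF).trans ?_
    calc _ ≤ ∑ j ∈ Finset.Ico k d, singVal σ j ^ 2 +
          singVal σ k ^ 2 * (k * ((sparsity (firstCols V k hk) : ℝ) - k)) := by
          rw [hfrob]
          gcongr
          exact specNorm_nonneg _
      _ = _ * ∑ j ∈ Finset.Ico k d, singVal σ j ^ 2 := by linear_combination (-(k : ℝ)) * hflat
      _ ≤ _ := mul_le_mul_of_nonneg_left hopt (by positivity)
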